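/- **Optimal state-dependent cloning fidelity.** Let $\phi\in[0,\pi/4)$ and let $|a\rangle=\cos\phi\,|0\rangle+\sin\phi\,|1\rangle$, $|b\rangle=\sin\phi\,|0\rangle+\cos\phi\,|1\rangle$ be qubit states, so that $\langle a|b\rangle=\sin 2\phi$; write $|aa\rangle=|a\rangle\otimes|a\rangle$, $|bb\rangle=|b\rangle\otimes|b\rangle$, $|a0\rangle=|a\rangle\otimes|0\rangle$, $|b0\rangle=|b\rangle\otimes|0\rangle$. Put $$\widetilde\Omega=2\arccos(\sin 2\phi)-2\arccos(\sin^2 2\phi).$$ Then: 1. $\widetilde\Omega\le 0$. 2. For all priors $\pi_1,\pi_2\ge 0$ with $\pi_1+\pi_2=1$, set $$\mathcal F(\pi_1,\pi_2)=\tfrac12+\tfrac12\sqrt{\pi_1^2+\pi_2^2+2\pi_1\pi_2\cos\widetilde\Omega}.$$ - (a) $\mathcal F(\pi_1,\pi_2)$ is the maximum of the global fidelity $\pi_1|\langle aa|U|a0\rangle|^2+\pi_2|\langle bb|U|b0\rangle|^2$ over all unitaries $U$ on $\mathbb C^2\otimes\mathbb C^2$. - (b) $\mathcal F(\pi_1,\pi_2)$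 is also the maximum of $\pi_1\operatorname{Tr}[\mathcal C(|a\rangle\langle a|)\,|aa\rangle\langle aa|]+\pi_2\operatorname{Tr}[\mathcal C(|b\rangle\langle b|)\,|bb\rangle\langle bb|]$ over all quantum operations (completely positive trace-preserving maps) $\mathcal C$ from one qubit to two qubits. - (c) For any unit vectors $s_1,s_2,t_1,t_2\in\mathbb C^2$ with $\langle s_1|s_2\rangle=\sin 2\phi$ and $\langle t_1|t_2\rangle=\sin^2 2\phi$ (the overlaps of $|a0\rangle,|b0\rangle$ and of $|aa\rangle,|bb\rangle$), $\mathcal F(\pi_1,\pi_2)$ is the maximum of $\pi_1\operatorname{Tr}[\mathcal C(|s_1\rangle\langle s_1|)\,|t_1\rangle\langle t_1|]+\pi_2\operatorname{Tr}[\mathcal C(|s_2\rangle\langle s_2|)\,|t_2\rangle\langle t_2|]$ over all qubit quantum operations $\mathcal C$. 3. For equal priors this is the optimum of Bruß et al.: $$\mathcal F(\tfrac12,\tfrac12)=\tfrac14\Big(\sqrt{1+\sin^2 2\phi}\,\sqrt{1+\sin 2\phi}+\cos 2\phi\,\sqrt{1-\sin 2\phi}\Big)^2,$$ and this number is the maximum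 over unitaries $U$ on $\mathbb C^2\otimes\mathbb C^2$ of $\tfrac12\big(|\langle aa|U|a0\rangle|^2+|\langle bb|U|b0\rangle|^2\big)$. -/

import Mathlib

namespace Cloning

open scoped ComplexOrder

/-- The squared modulus `|⟨u|v⟩|²` of the standard inner product (conjugate-linear in `u`). -/
noncomputable def overlapSq {ι : Type*} [Fintype ι] (u v : ι → ℂ) : ℝ :=
  ‖star u ⬝ᵥ v‖ ^ 2

/-- The product vector `|u⟩ ⊗ |v⟩`. -/
def tensor {ι κ : Type*} (u : ι → ℂ) (v : κ → ℂ) : ι × κ → ℂ :=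
  fun p => u p.1 * v p.2

/-- The blank state `|0⟩` of a qubit. -/
def ket0 : Fin 2 → ℂ := ![1, 0]

/-- `|a⟩ = cos φ |0⟩ + sin φ |1⟩`. -/
noncomputable def ketA (φ : ℝ) : Fin 2 → ℂ := ![(Real.cos φ : ℂ), (Real.sin φ : ℂ)]

/-- `|b⟩ = sin φ |0⟩ + cos φ |1⟩`. -/
noncomputable def ketB (φ : ℝ) : Fin 2 → ℂ := ![(Real.sin φ : ℂ), (Real.cos φ : ℂ)]

/-- The global fidelity `π₁ |⟨aa|U|a0⟩|² + π₂ |⟨bb|U|b0⟩|²` of a two-qubit cloning unitary `U`. -/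
noncomputable def globalFidelity (π₁ π₂ φ : ℝ)
    (U : Matrix.unitaryGroup (Fin 2 × Fin 2) ℂ) : ℝ :=
  π₁ * overlapSq (tensor (ketA φ) (ketA φ))
      ((U : Matrix (Fin 2 × Fin 2) (Fin 2 × Fin 2) ℂ).mulVec (tensor (ketA φ) ket0)) +
  π₂ * overlapSq (tensor (ketB φ) (ketB φ))
      ((U : Matrix (Fin 2 × Fin 2) (Fin 2 × Fin 2) ℂ).mulVec (tensor (ketB φ) ket0))

/-- The trace of an element of the C⋆-algebra of `ι × ι` complex matrices. -/
noncomputable def tr {ι : Type*} [Fintype ι] (X : CStarMatrix ι ι ℂ) : ℂ :=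
  Matrix.trace (CStarMatrix.ofMatrix.symm X)

/-- The rank-one operator `|v⟩⟨v|`. -/
noncomputable def pureState {ι : Type*} (v : ι → ℂ) : CStarMatrix ι ι ℂ :=
  CStarMatrix.ofMatrix (Matrix.vecMulVec v (star v))

/-- Quantum operations: completely positive trace-preserving maps from operators on `ℂ^ι` to
operators on `ℂ^κ`. -/
structure QuantumOperation (ι κ : Type) [Fintype ι] [DecidableEq ι] [Fintype κ]
    [DecidableEq κ] where
  /-- The underlying completely positive map. -/
  toCP : CompletelyPositiveMap (CStarMatrix ι ι ℂ) (CStarMatrix κ κ ℂ)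
  /-- The map preserves the trace. -/
  tr_map : ∀ X : CStarMatrix ι ι ℂ, tr (toCP X) = tr X

/-- The average fidelity `π₁ Tr[C(|s₁⟩⟨s₁|) |t₁⟩⟨t₁|] + π₂ Tr[C(|s₂⟩⟨s₂|) |t₂⟩⟨t₂|]` of a quantum
operation `C` for transforming the pure states `s₁, s₂` into the pure states `t₁, t₂`. Both traces
are real, as traces of products of two positive semidefinite matrices. -/
noncomputable def trackingFidelity {ι κ : Type} [Fintype ι] [DecidableEq ι] [Fintype κ]
    [DecidableEq κ] (π₁ π₂ : ℝ) (s₁ s₂ : ι → ℂ) (t₁ t₂ : κ → ℂ) (C : QuantumOperation ι κ) : ℝ :=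
  π₁ * (tr (C.toCP (pureState s₁) * pureState t₁)).re +
  π₂ * (tr (C.toCP (pureState s₂) * pureState t₂)).re

/-- `Ω̃ = 2 arccos (sin 2φ) - 2 arccos (sin² 2φ)`. -/
noncomputable def indicator (φ : ℝ) : ℝ :=
  2 * Real.arccos (Real.sin (2 * φ)) - 2 * Real.arccos (Real.sin (2 * φ) ^ 2)

/-- `1/2 + 1/2 √(π₁² + π₂² + 2 π₁ π₂ cos Ω̃)`. -/
noncomputable def optimalFidelity (π₁ π₂ φ : ℝ) : ℝ :=
  1 / 2 + 1 / 2 * Real.sqrt (π₁ ^ 2 + π₂ ^ 2 + 2 * π₁ * π₂ * Real.cos (indicator φ))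

/-- The optimal global fidelity of the state-dependent cloner of Bruß, DiVincenzo, Ekert, Fuchs,
Macchiavello and Smolin (equal priors). -/
noncomputable def brussFidelity (φ : ℝ) : ℝ :=
  1 / 4 * (Real.sqrt (1 + Real.sin (2 * φ) ^ 2) * Real.sqrt (1 + Real.sin (2 * φ)) +
    Real.cos (2 * φ) * Real.sqrt (1 - Real.sin (2 * φ))) ^ 2

end Cloning

namespace Cloning

open scoped ComplexOrder

/-! Squared overlaps are `(1 + cos 2θ) / 2` for angles `θ` between vectors, so the problem becomes
plane geometry. The sources are closer in angle than the targets. By the triangle inequality, the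
two errors must together bridge the gap `arccos t - arccos c` between the target and source angles,
where `t` and `c` are the overlaps. Maximising `p cos x + q cos y` under `x + y ≥ T`, with `T` twice
the gap, gives the square root (`mul_norm_inner_sq_add_le`). Equality holds when the output pair
lies in the real plane of the targets with the gap split optimally (`exists_optimal_pair`), and a
unitary reaches this pair since equal overlaps make pairs unitarily equivalent
(`exists_unitary_mulVec_eq`). General operations do no better: 2-positivity purifies the two outputs
(`exists_purification`), trace preservation keeps the source overlap, and each fidelity becomes an
overlap with a purified target. The ancilla can only shrink the target overlap, so the same bound
applies (`trackingFidelity_le`). -/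

/-! ### Weighted sums of two cosines -/

lemma mul_cos_add_mul_cos_le {p q x y T : ℝ} (hp : 0 ≤ p) (hq : 0 ≤ q)
    (hx : x ∈ Set.Icc 0 Real.pi) (hy : y ∈ Set.Icc 0 Real.pi) (hT : 0 ≤ T) (h : T ≤ x + y) :
    p * Real.cos x + q * Real.cos y ≤ √(p ^ 2 + q ^ 2 + 2 * p * q * Real.cos T) := by
  -- Cosine decreases on `[0, π]`, so the angles may be shrunk until they sum to exactly `T`.
  obtain ⟨x', y', hx', hy', hxx, hyy, rfl⟩ :
      ∃ x' y', 0 ≤ x' ∧ 0 ≤ y' ∧ x' ≤ x ∧ y' ≤ y ∧ T = x' + y' := by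
    rcases le_total x T with hxT | hxT
    · exact ⟨x, T - x, hx.1, by linarith, le_rfl, by linarith, by ring⟩
    · exact ⟨T, 0, hT, le_rfl, hxT, hy.1, by ring⟩
  have h1 := Real.cos_le_cos_of_nonneg_of_le_pi hx' hx.2 hxx
  have h2 := Real.cos_le_cos_of_nonneg_of_le_pi hy' hy.2 hyy
  calc p * Real.cos x + q * Real.cos y ≤ p * Real.cos x' + q * Real.cos y' := by gcongr
    _ ≤ _ := by
      apply Real.le_sqrt_of_sq_le
      rw [Real.cos_add]
      -- The gap between the two squared sides is exactly this square.
      nlinarith [sq_nonneg (p * Real.sin x' - q * Real.sin y'), Real.sin_sq_add_cos_sq x',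
        Real.sin_sq_add_cos_sq y']

/-- The left side is the real part of `e^{-ix} (p + q e^{iT})`, which equals the modulus when `x` is
the argument of `p + q e^{iT}`. -/
lemma exists_mul_cos_add_mul_cos_eq (p q T : ℝ) :
    ∃ x, p * Real.cos x + q * Real.cos (T - x) =
      √(p ^ 2 + q ^ 2 + 2 * p * q * Real.cos T) := by
  set z : ℂ := ⟨p + q * Real.cos T, q * Real.sin T⟩ with hz
  have hr : √(p ^ 2 + q ^ 2 + 2 * p * q * Real.cos T) = ‖z‖ := by
    rw [Complex.norm_def, Complex.normSq_mk]
    congr 1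
    linear_combination (-q ^ 2) * Real.sin_sq_add_cos_sq T
  refine ⟨z.arg, ?_⟩
  have h1 : ‖z‖ * Real.cos z.arg = p + q * Real.cos T := Complex.norm_mul_cos_arg z
  have h2 : ‖z‖ * Real.sin z.arg = q * Real.sin T := Complex.norm_mul_sin_arg z
  rw [hr, Real.cos_sub]
  linear_combination (-Real.cos z.arg) * h1 - Real.sin z.arg * h2 +
    ‖z‖ * Real.sin_sq_add_cos_sq z.arg

/-! ### The sign of the indicator and the case of equal priors -/

lemma sin_two_mul_mem {φ : ℝ} (hφ : φ ∈ Set.Ico 0 (Real.pi / 4)) :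
    Real.sin (2 * φ) ∈ Set.Ico (0 : ℝ) 1 := by
  refine ⟨Real.sin_nonneg_of_nonneg_of_le_pi (by linarith [hφ.1]) (by linarith [hφ.2, hφ.1]), ?_⟩
  rw [← Real.sin_pi_div_two]
  exact Real.sin_lt_sin_of_lt_of_le_pi_div_two (by linarith [hφ.1, Real.pi_pos]) le_rfl
    (by linarith [hφ.2])

lemma indicator_nonpos {φ : ℝ} (hφ : φ ∈ Set.Ico 0 (Real.pi / 4)) : indicator φ ≤ 0 := by
  obtain ⟨h0, h1⟩ := sin_two_mul_mem hφ
  have : Real.arccos (Real.sin (2 * φ)) ≤ Real.arccos (Real.sin (2 * φ) ^ 2) :=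
    Real.arccos_le_arccos (by nlinarith)
  unfold indicator
  linarith

lemma optimalFidelity_half {φ : ℝ} (hφ : φ ∈ Set.Ico 0 (Real.pi / 4)) :
    optimalFidelity (1 / 2) (1 / 2) φ = brussFidelity φ := by
  obtain ⟨h0, h1⟩ := sin_two_mul_mem hφ
  have hc : Real.cos (2 * φ) = √(1 - Real.sin (2 * φ) ^ 2) :=
    Real.cos_eq_sqrt_one_sub_sin_sq (by linarith [hφ.1, Real.pi_pos]) (by linarith [hφ.2])
  unfold optimalFidelity brussFidelity indicator
  rw [hc]
  set s := Real.sin (2 * φ)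
  have hs2 : s ^ 2 ≤ 1 := by nlinarith
  have hcos : Real.cos (Real.arccos s - Real.arccos (s ^ 2)) =
      s ^ 3 + (1 - s ^ 2) * √(1 + s ^ 2) := by
    rw [Real.cos_sub, Real.cos_arccos (by linarith) h1.le, Real.cos_arccos (by nlinarith) hs2,
      Real.sin_arccos, Real.sin_arccos,
      show 1 - (s ^ 2) ^ 2 = (1 - s ^ 2) * (1 + s ^ 2) by ring,
      Real.sqrt_mul (by linarith), ← mul_assoc, Real.mul_self_sqrt (by linarith)]
    ring
  have hn : 0 ≤ s ^ 3 + (1 - s ^ 2) * √(1 + s ^ 2) :=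
    add_nonneg (by positivity) (mul_nonneg (by linarith) (by positivity))
  -- For equal priors the radicand is the square of the cosine of half the indicator.
  rw [← mul_sub, Real.cos_two_mul, hcos,
    show ((1 : ℝ) / 2) ^ 2 + (1 / 2) ^ 2 + 2 * (1 / 2) * (1 / 2) *
      (2 * (s ^ 3 + (1 - s ^ 2) * √(1 + s ^ 2)) ^ 2 - 1) =
      (s ^ 3 + (1 - s ^ 2) * √(1 + s ^ 2)) ^ 2 by ring, Real.sqrt_sq hn]
  have e : √(1 - s ^ 2) = √(1 + s) * √(1 - s) := by
    rw [← Real.sqrt_mul (by linarith)]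
    ring_nf
  have a := Real.sq_sqrt (show 0 ≤ 1 + s by linarith)
  have b := Real.sq_sqrt (show 0 ≤ 1 - s by linarith)
  have c := Real.sq_sqrt (show 0 ≤ 1 + s ^ 2 by positivity)
  rw [e, show (√(1 + s ^ 2) * √(1 + s) + √(1 + s) * √(1 - s) * √(1 - s)) ^ 2 =
    √(1 + s) ^ 2 * (√(1 + s ^ 2) + √(1 - s) ^ 2) ^ 2 by ring, a, b, add_sq, c]
  ring

/-! ### Upper bound for pairs of vectors -/

/-- The angle triangle inequality turns the overlaps of sources and targets into a bound on the
average fidelity. -/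
lemma mul_norm_inner_sq_add_le {E : Type*} [NormedAddCommGroup E] [InnerProductSpace ℂ E]
    {p q c t : ℝ} (hp : 0 ≤ p) (hq : 0 ≤ q) (hpq : p + q = 1) (htc : t ≤ c)
    {x y u v : E} (hx : ‖x‖ = 1) (hy : ‖y‖ = 1) (hu : ‖u‖ = 1) (hv : ‖v‖ = 1)
    (hxy : inner ℂ x y = (c : ℂ)) (huv : ‖inner ℂ u v‖ ≤ t) :
    p * ‖inner ℂ u x‖ ^ 2 + q * ‖inner ℂ v y‖ ^ 2 ≤
      1 / 2 + 1 / 2 * √(p ^ 2 + q ^ 2 +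
        2 * p * q * Real.cos (2 * Real.arccos c - 2 * Real.arccos t)) := by
  -- A phase makes each overlap real and nonnegative, so that real angles measure its modulus.
  have phase (w z : E) (hw : ‖w‖ = 1) :
      ∃ k : ℂ, ‖k‖ = 1 ∧ (inner ℂ (k • w) z).re = ‖inner ℂ w z‖ := by
    obtain ⟨k, hk, hk'⟩ := RCLike.exists_norm_mul_eq_self (inner ℂ w z)
    have hkk : star k * k = 1 := by
      rw [Complex.star_def, ← Complex.normSq_eq_conj_mul_self, Complex.normSq_eq_norm_sq, hk]; simp
    refine ⟨k, hk, ?_⟩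
    rw [inner_smul_left, ← hk', ← mul_assoc]
    have : (starRingEnd ℂ) k * k = 1 := hkk
    simp [this, hk]
  obtain ⟨k, hk, hku⟩ := phase u x hu
  obtain ⟨l, hl, hlv⟩ := phase v y hv
  let _ : InnerProductSpace ℝ E := InnerProductSpace.rclikeToReal ℂ E
  have hin (a b : E) : inner ℝ a b = (inner ℂ a b).re := rfl
  have hku1 : ‖k • u‖ = 1 := by rw [norm_smul, hk, hu, one_mul]
  have hlv1 : ‖l • v‖ = 1 := by rw [norm_smul, hl, hv, one_mul]
  have h1 : InnerProductGeometry.angle (k • u) x = Real.arccos ‖inner ℂ u x‖ := by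
    rw [InnerProductGeometry.angle, hin, hku, hku1, hx]; simp
  have h2 : InnerProductGeometry.angle y (l • v) = Real.arccos ‖inner ℂ v y‖ := by
    rw [InnerProductGeometry.angle_comm, InnerProductGeometry.angle, hin, hlv, hlv1, hy]; simp
  have h3 : InnerProductGeometry.angle x y = Real.arccos c := by
    rw [InnerProductGeometry.angle, hin, hxy, hx, hy]; simp
  have h4 : Real.arccos t ≤ InnerProductGeometry.angle (k • u) (l • v) := by
    rw [InnerProductGeometry.angle, hin, hku1, hlv1]
    apply Real.arccos_le_arccos
    rw [mul_one, div_one]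
    refine (Complex.re_le_norm _).trans ?_
    rw [inner_smul_left, inner_smul_right]
    simpa [hk, hl] using huv
  have h5 := InnerProductGeometry.angle_le_angle_add_angle (k • u) x (l • v)
  have h6 := InnerProductGeometry.angle_le_angle_add_angle x y (l • v)
  have cs (a b : E) (ha : ‖a‖ = 1) (hb : ‖b‖ = 1) : ‖inner ℂ a b‖ ≤ 1 := by
    simpa [ha, hb] using norm_inner_le_norm (𝕜 := ℂ) a b
  have hcos (r : ℝ) (h0 : 0 ≤ r) (hr : r ≤ 1) :
      -- Doubling the angle makes the fidelity affine in cosines; as `r ≥ 0`, the doubled angle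
      -- stays in `[0, π]`.
      r ^ 2 = 1 / 2 + 1 / 2 * Real.cos (2 * Real.arccos r) := by
    rw [Real.cos_two_mul, Real.cos_arccos (by linarith) hr]; ring
  have hmem (r : ℝ) (h0 : 0 ≤ r) : 2 * Real.arccos r ∈ Set.Icc 0 Real.pi :=
    ⟨by linarith [Real.arccos_nonneg r], by linarith [Real.arccos_le_pi_div_two.2 h0]⟩
  have key := mul_cos_add_mul_cos_le hp hq (hmem ‖inner ℂ u x‖ (norm_nonneg _))
    (hmem ‖inner ℂ v y‖ (norm_nonneg _))
    (T := 2 * Real.arccos t - 2 * Real.arccos c)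
    (by linarith [Real.arccos_le_arccos htc]) (by linarith)
  rw [hcos _ (norm_nonneg _) (cs u x hu hx), hcos _ (norm_nonneg _) (cs v y hv hy),
    ← neg_sub (2 * Real.arccos t), Real.cos_neg]
  linear_combination (1 / 2) * key + (1 / 2) * hpq

lemma inner_toLp {ι : Type*} [Fintype ι] (u v : ι → ℂ) :
    inner ℂ (WithLp.toLp 2 u) (WithLp.toLp 2 v) = star u ⬝ᵥ v := by
  rw [EuclideanSpace.inner_toLp_toLp, dotProduct_comm]

lemma norm_toLp {ι : Type*} [Fintype ι] {u : ι → ℂ} (hu : star u ⬝ᵥ u = 1) :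
    ‖WithLp.toLp 2 u‖ = 1 := by
  have h : ‖WithLp.toLp 2 u‖ ^ 2 = 1 := by
    rw [← inner_self_eq_norm_sq (𝕜 := ℂ), inner_toLp, hu]
    simp
  exact (pow_eq_one_iff_of_nonneg (norm_nonneg _) two_ne_zero).1 h

/-- The target overlap is only bounded, not prescribed: purified targets carry an extra ancilla
factor of modulus at most one. -/
lemma mul_overlapSq_add_le {ι : Type*} [Fintype ι] {π₁ π₂ φ : ℝ}
    (hφ : φ ∈ Set.Ico 0 (Real.pi / 4)) (h₁ : 0 ≤ π₁) (h₂ : 0 ≤ π₂) (h : π₁ + π₂ = 1)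
    {x y u v : ι → ℂ} (hx : star x ⬝ᵥ x = 1) (hy : star y ⬝ᵥ y = 1) (hu : star u ⬝ᵥ u = 1)
    (hv : star v ⬝ᵥ v = 1) (hxy : star x ⬝ᵥ y = ((Real.sin (2 * φ) : ℝ) : ℂ))
    (huv : ‖star u ⬝ᵥ v‖ ≤ Real.sin (2 * φ) ^ 2) :
    π₁ * overlapSq u x + π₂ * overlapSq v y ≤ optimalFidelity π₁ π₂ φ := by
  obtain ⟨h0, h1⟩ := sin_two_mul_mem hφ
  have := mul_norm_inner_sq_add_le h₁ h₂ h (by nlinarith : Real.sin (2 * φ) ^ 2 ≤ Real.sin (2 * φ))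
    (norm_toLp hx) (norm_toLp hy) (norm_toLp hu) (norm_toLp hv)
    (by rw [inner_toLp, hxy]) (by rwa [inner_toLp])
  simpa only [inner_toLp, overlapSq, optimalFidelity, indicator] using this

/-! ### A pair attaining the bound -/

lemma star_dotProduct_comm {ι : Type*} [Fintype ι] {u v : ι → ℂ} {c : ℝ}
    (h : star u ⬝ᵥ v = (c : ℂ)) : star v ⬝ᵥ u = (c : ℂ) := by
  have := congrArg star h
  rw [Matrix.star_dotProduct, star_star] at this
  rw [this]
  simp

lemma dotProduct_real_combination {ι : Type*} [Fintype ι] {u v : ι → ℂ} {c : ℝ}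
    (hu : star u ⬝ᵥ u = 1) (hv : star v ⬝ᵥ v = 1) (huv : star u ⬝ᵥ v = (c : ℂ))
    (a b a' b' : ℝ) :
    star ((a : ℂ) • u + (b : ℂ) • v) ⬝ᵥ ((a' : ℂ) • u + (b' : ℂ) • v) =
      ((a * a' + b * b' + (a * b' + b * a') * c : ℝ) : ℂ) := by
  simp only [star_add, star_smul, add_dotProduct, dotProduct_add, smul_dotProduct,
    dotProduct_smul, hu, hv, huv, star_dotProduct_comm huv, smul_eq_mul, RCLike.star_def,
    Complex.conj_ofReal]
  push_cast
  ring

/-- Two unit vectors with the overlap of the sources, in the plane of the targets, whose average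
fidelity with the targets is optimal. -/
lemma exists_optimal_pair {κ : Type*} [Fintype κ] {π₁ π₂ φ : ℝ}
    (hφ : φ ∈ Set.Ico 0 (Real.pi / 4)) (h : π₁ + π₂ = 1) {u v : κ → ℂ}
    (hu : star u ⬝ᵥ u = 1) (hv : star v ⬝ᵥ v = 1)
    (huv : star u ⬝ᵥ v = ((Real.sin (2 * φ) ^ 2 : ℝ) : ℂ)) :
    ∃ x y : κ → ℂ, star x ⬝ᵥ x = 1 ∧ star y ⬝ᵥ y = 1 ∧
      star x ⬝ᵥ y = ((Real.sin (2 * φ) : ℝ) : ℂ) ∧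
      π₁ * overlapSq u x + π₂ * overlapSq v y = optimalFidelity π₁ π₂ φ := by
  obtain ⟨h0, h1⟩ := sin_two_mul_mem hφ
  unfold optimalFidelity indicator
  set s := Real.sin (2 * φ)
  have hs2 : s ^ 2 < 1 := by nlinarith
  set B := Real.arccos (s ^ 2) with hB
  have hcB : Real.cos B = s ^ 2 := Real.cos_arccos (by nlinarith) hs2.le
  have hsB : Real.sin B ≠ 0 := by
    rw [hB, Real.sin_arccos]
    exact (Real.sqrt_pos.2 (by nlinarith)).ne'
  -- The unit vector at angle `γ` from `u` towards `v` in their real plane.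
  let ψ (γ : ℝ) : κ → ℂ := ((Real.sin (B - γ) / Real.sin B : ℝ) : ℂ) • u +
    ((Real.sin γ / Real.sin B : ℝ) : ℂ) • v
  have hψ (γ δ : ℝ) : star (ψ γ) ⬝ᵥ ψ δ = ((Real.cos (γ - δ) : ℝ) : ℂ) := by
    simp only [ψ]
    rw [dotProduct_real_combination hu hv huv]
    congr 1
    rw [← hcB, Real.sin_sub, Real.sin_sub, Real.cos_sub]
    field_simp
    linear_combination (-Real.sin γ * Real.sin δ) * Real.sin_sq_add_cos_sq B
  have hψu : ψ 0 = u := by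
    simp only [ψ, sub_zero, Real.sin_zero, zero_div, div_self hsB]
    simp
  have hψv : ψ B = v := by
    simp only [ψ, sub_self, Real.sin_zero, zero_div, div_self hsB]
    simp
  obtain ⟨x, hx⟩ := exists_mul_cos_add_mul_cos_eq π₁ π₂ (2 * B - 2 * Real.arccos s)
  -- The angles are halved because `x` is a doubled angle; the separation `arccos s` enforces the
  -- source overlap.
  refine ⟨ψ (x / 2), ψ (x / 2 + Real.arccos s), by simp [hψ], by simp [hψ], ?_, ?_⟩
  · rw [hψ, sub_add_cancel_left, Real.cos_neg, Real.cos_arccos (by linarith) h1.le]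
  · rw [← neg_sub (2 * B), Real.cos_neg, ← hx]
    nth_rw 1 [← hψu, ← hψv]
    simp only [overlapSq, hψ, Complex.norm_real, Real.norm_eq_abs, sq_abs, zero_sub, Real.cos_neg]
    rw [show x = 2 * (x / 2) by ring,
      show 2 * B - 2 * Real.arccos s - 2 * (x / 2) = 2 * (B - (x / 2 + Real.arccos s)) by ring,
      Real.cos_two_mul, Real.cos_two_mul, show 2 * (x / 2) / 2 = x / 2 by ring]
    linear_combination (1 / 2) * h

/-! ### Unitary equivalence of pairs -/

/-- Gram–Schmidt. The coordinates depend on `c` alone, so matching the bases of two pairs with equal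
overlap matches the pairs. -/
lemma exists_orthonormalBasis_of_pair {ι : Type*} [Fintype ι] {i j : ι} (hij : i ≠ j)
    {x y : EuclideanSpace ℂ ι} (hx : ‖x‖ = 1) (hy : ‖y‖ = 1) {c : ℝ} (hc : c ^ 2 < 1)
    (hxy : inner ℂ x y = (c : ℂ)) :
    ∃ b : OrthonormalBasis ι ℂ (EuclideanSpace ℂ ι),
      b i = x ∧ y = (c : ℂ) • b i + (√(1 - c ^ 2) : ℂ) • b j := by
  classical
  have hr : (√(1 - c ^ 2) : ℂ) ≠ 0 := by
    exact_mod_cast (Real.sqrt_pos.2 (by linarith)).ne'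
  have hrr : (√(1 - c ^ 2) : ℂ) * √(1 - c ^ 2) = 1 - c * c := by
    rw [← Complex.ofReal_mul, Real.mul_self_sqrt (by linarith)]
    push_cast
    ring
  have hyx : inner ℂ y x = (c : ℂ) := by
    rw [← inner_conj_symm, hxy, Complex.conj_ofReal]
  have hxx : inner ℂ x x = (1 : ℂ) := by rw [inner_self_eq_norm_sq_to_K, hx]; simp
  have hyy : inner ℂ y y = (1 : ℂ) := by rw [inner_self_eq_norm_sq_to_K, hy]; simp
  set z : EuclideanSpace ℂ ι := (√(1 - c ^ 2) : ℂ)⁻¹ • (y - (c : ℂ) • x) with hz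
  have hxz : inner ℂ x z = (0 : ℂ) := by
    rw [hz, inner_smul_right, inner_sub_right, inner_smul_right, hxx, hxy]
    simp
  have hzz : inner ℂ z z = (1 : ℂ) := by
    simp only [hz, inner_smul_right, inner_smul_left, inner_sub_left, inner_sub_right, hxx, hyy,
      hxy, hyx, map_inv₀, Complex.conj_ofReal]
    field_simp
    linear_combination -hrr
  have hzn : ‖z‖ = 1 := by
    have h : ‖z‖ ^ 2 = 1 := by
      rw [← inner_self_eq_norm_sq (𝕜 := ℂ), hzz]
      simp
    exact (pow_eq_one_iff_of_nonneg (norm_nonneg _) two_ne_zero).1 h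
  -- Only the values at `i` and `j` matter; elsewhere `z` is a filler.
  let v : ι → EuclideanSpace ℂ ι := fun k => if k = i then x else z
  have hv : Orthonormal ℂ (({i, j} : Set ι).domRestrict v) := by
    constructor
    · rintro ⟨k, hk⟩
      change ‖v k‖ = 1
      by_cases h : k = i <;> simp [v, h, hx, hzn]
    · rintro ⟨k, hk⟩ ⟨l, hl⟩ hkl
      have hkl' : k ≠ l := fun h => hkl (Subtype.ext h)
      have hzx : inner ℂ z x = (0 : ℂ) := by rw [← inner_conj_symm, hxz, map_zero]
      change inner ℂ (v k) (v l) = 0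
      rcases hk with rfl | rfl <;> rcases hl with rfl | rfl
      · exact absurd rfl hkl'
      · simpa [v, hij.symm] using hxz
      · simpa [v, hij.symm] using hzx
      · exact absurd rfl hkl'
  obtain ⟨b, hb⟩ := hv.exists_orthonormalBasis_extension_of_card_eq (by simp)
  have hbi : b i = x := by rw [hb i (by simp)]; simp [v]
  have hbj : b j = z := by rw [hb j (by simp)]; simp [v, hij.symm]
  refine ⟨b, hbi, ?_⟩
  rw [hbi, hbj, hz, smul_smul, mul_inv_cancel₀ hr, one_smul, add_sub_cancel]

/-- Pairs of unit vectors with the same overlap are unitarily equivalent. -/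
lemma exists_unitary_mulVec_eq {ι : Type*} [Fintype ι] [DecidableEq ι] [Nontrivial ι]
    {x y u v : ι → ℂ} (hx : star x ⬝ᵥ x = 1) (hy : star y ⬝ᵥ y = 1) (hu : star u ⬝ᵥ u = 1)
    (hv : star v ⬝ᵥ v = 1) {c : ℝ} (hc : c ^ 2 < 1) (hxy : star x ⬝ᵥ y = (c : ℂ))
    (huv : star u ⬝ᵥ v = (c : ℂ)) :
    ∃ U : Matrix.unitaryGroup ι ℂ,
      (U : Matrix ι ι ℂ).mulVec x = u ∧ (U : Matrix ι ι ℂ).mulVec y = v := by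
  obtain ⟨i, j, hij⟩ := exists_pair_ne ι
  obtain ⟨b, hb, hby⟩ := exists_orthonormalBasis_of_pair hij (norm_toLp hx) (norm_toLp hy) hc
    (by rw [inner_toLp, hxy])
  obtain ⟨d, hd, hdv⟩ := exists_orthonormalBasis_of_pair hij (norm_toLp hu) (norm_toLp hv) hc
    (by rw [inner_toLp, huv])
  let e := b.equiv d (Equiv.refl ι)
  let W := Unitary.linearIsometryEquiv.symm e
  have hW (z) : (W : EuclideanSpace ℂ ι →L[ℂ] EuclideanSpace ℂ ι) z = e z := by simp [W]
  have he (k) : e (b k) = d k := by simp [e]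
  obtain ⟨U, hUW⟩ := EquivLike.surjective (Matrix.toEuclideanCLM (n := ι) (𝕜 := ℂ))
    (W : EuclideanSpace ℂ ι →L[ℂ] EuclideanSpace ℂ ι)
  have hU (z : ι → ℂ) : WithLp.toLp 2 (U.mulVec z) = e (WithLp.toLp 2 z) := by
    rw [← hW, ← hUW, Matrix.toEuclideanCLM_toLp]
  have hUu : U ∈ Matrix.unitaryGroup ι ℂ := by
    rw [Matrix.mem_unitaryGroup_iff']
    apply EquivLike.injective (Matrix.toEuclideanCLM (n := ι) (𝕜 := ℂ))
    rw [map_mul, map_star, hUW, map_one]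
    exact Unitary.coe_star_mul_self W
  refine ⟨⟨U, hUu⟩, ?_, ?_⟩
  · apply WithLp.toLp_injective 2
    change WithLp.toLp 2 (U.mulVec x) = _
    rw [hU, ← hb, he, hd]
  · apply WithLp.toLp_injective 2
    change WithLp.toLp 2 (U.mulVec y) = _
    rw [hU, hby, map_add, map_smul, map_smul, he, he, hdv]

/-! ### Quantum operations from isometries -/

/-- Conjugation by an isometry, as a homomorphism of star algebras. -/
noncomputable def isometryConj {ι κ : Type*} [Fintype ι] [DecidableEq ι] [Fintype κ]
    (W : Matrix κ ι ℂ) (hW : W.conjTranspose * W = 1) :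
    CStarMatrix ι ι ℂ →⋆ₙₐ[ℂ] CStarMatrix κ κ ℂ where
  toFun X := CStarMatrix.ofMatrix (W * CStarMatrix.ofMatrix.symm X * W.conjTranspose)
  map_smul' c X := congrArg CStarMatrix.ofMatrix
    (a₁ := W * (c • CStarMatrix.ofMatrix.symm X) * W.conjTranspose)
    (a₂ := c • (W * CStarMatrix.ofMatrix.symm X * W.conjTranspose)) (by simp)
  map_zero' := congrArg CStarMatrix.ofMatrix (a₁ := W * (0 : Matrix ι ι ℂ) * W.conjTranspose)
    (a₂ := 0) (by simp)
  map_add' X Y := congrArg CStarMatrix.ofMatrix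
    (a₁ := W * (CStarMatrix.ofMatrix.symm X + CStarMatrix.ofMatrix.symm Y) * W.conjTranspose)
    (a₂ := W * CStarMatrix.ofMatrix.symm X * W.conjTranspose +
      W * CStarMatrix.ofMatrix.symm Y * W.conjTranspose)
    (by rw [Matrix.mul_add, Matrix.add_mul])
  map_mul' X Y := congrArg CStarMatrix.ofMatrix
    (a₁ := W * (CStarMatrix.ofMatrix.symm X * CStarMatrix.ofMatrix.symm Y) * W.conjTranspose)
    (a₂ := (W * CStarMatrix.ofMatrix.symm X * W.conjTranspose) *
      (W * CStarMatrix.ofMatrix.symm Y * W.conjTranspose)) (by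
    simp only [Matrix.mul_assoc]
    rw [← Matrix.mul_assoc W.conjTranspose W, hW, Matrix.one_mul])
  map_star' X := congrArg CStarMatrix.ofMatrix
    (a₁ := W * (CStarMatrix.ofMatrix.symm X).conjTranspose * W.conjTranspose)
    (a₂ := (W * CStarMatrix.ofMatrix.symm X * W.conjTranspose).conjTranspose)
    (by simp [Matrix.mul_assoc])

/-- The quantum operation `X ↦ W X W*` of an isometry `W`. -/
noncomputable def QuantumOperation.ofIsometry {ι κ : Type} [Fintype ι] [DecidableEq ι] [Fintype κ]
    [DecidableEq κ] (W : Matrix κ ι ℂ) (hW : W.conjTranspose * W = 1) : QuantumOperation ι κ where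
  toCP := CompletelyPositiveMapClass.toCompletelyPositiveLinearMap (isometryConj W hW)
  tr_map X := by
    change Matrix.trace (W * CStarMatrix.ofMatrix.symm X * W.conjTranspose) = Matrix.trace _
    rw [Matrix.trace_mul_comm, ← Matrix.mul_assoc, hW, Matrix.one_mul]

lemma tr_ofIsometry_mul_pureState {ι κ : Type} [Fintype ι] [DecidableEq ι] [Fintype κ]
    [DecidableEq κ] (W : Matrix κ ι ℂ) (hW : W.conjTranspose * W = 1) (s : ι → ℂ) (t : κ → ℂ) :
    (tr ((QuantumOperation.ofIsometry W hW).toCP (pureState s) * pureState t)).re =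
      overlapSq t (W.mulVec s) := by
  change (Matrix.trace (W * Matrix.vecMulVec s (star s) * W.conjTranspose *
    Matrix.vecMulVec t (star t))).re = _
  rw [Matrix.mul_vecMulVec W, Matrix.vecMulVec_mul, ← Matrix.star_mulVec,
    Matrix.vecMulVec_mul_vecMulVec, Matrix.trace_vecMulVec, overlapSq, dotProduct_smul,
    dotProduct_comm (W.mulVec s), Matrix.star_dotProduct (W.mulVec s), smul_eq_mul,
    Complex.star_def, ← Complex.normSq_eq_conj_mul_self, Complex.ofReal_re,
    Complex.normSq_eq_norm_sq]

/-! ### Purification and the bound for quantum operations -/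

lemma exists_eq_star_mul_self {A : Type*} [NonUnitalCStarAlgebra A] [PartialOrder A]
    [StarOrderedRing A] {a : A} (ha : 0 ≤ a) : ∃ b, a = star b * b :=
  CStarAlgebra.nonneg_iff_eq_star_mul_self.1 ha

/-- A completely positive map sends the dyads of a pair of vectors to a Gram matrix of operators:
this is the purification of the two outputs. -/
lemma exists_purification {ι κ : Type} [Fintype ι] [DecidableEq ι] [Fintype κ] [DecidableEq κ]
    (C : CompletelyPositiveMap (CStarMatrix ι ι ℂ) (CStarMatrix κ κ ℂ)) (s : Fin 2 → ι → ℂ) :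
    ∃ V : Fin 2 → Fin 2 → Matrix κ κ ℂ, ∀ i j,
      CStarMatrix.ofMatrix.symm
        (C (CStarMatrix.ofMatrix (Matrix.vecMulVec (s i) (star (s j))))) =
        ∑ k, (V k i).conjTranspose * V k j := by
  by_cases hι : IsEmpty ι
  · refine ⟨0, fun i j => ?_⟩
    have : CStarMatrix.ofMatrix (Matrix.vecMulVec (s i) (star (s j))) = 0 := by
      ext i
      exact hι.elim i
    rw [this, map_zero]
    simp
    rfl
  rw [not_isEmpty_iff] at hι
  obtain ⟨o⟩ := hι
  -- The row of operators `|o⟩⟨s j|`, padded by a zero row to a square, exhibits the block matrix of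
  -- dyads as `star R * R`, hence positive.
  let R : CStarMatrix (Fin 2) (Fin 2) (CStarMatrix ι ι ℂ) := CStarMatrix.ofMatrix fun k j =>
    if k = 0 then CStarMatrix.ofMatrix (Matrix.vecMulVec (Pi.single o 1) (star (s j))) else 0
  have hR (i j) : (star R * R) i j =
      CStarMatrix.ofMatrix (Matrix.vecMulVec (s i) (star (s j))) := by
    have h0 (l) : R 0 l =
      CStarMatrix.ofMatrix (Matrix.vecMulVec (Pi.single o 1) (star (s l))) := rfl
    have h1 (l) : R 1 l = 0 := rfl
    rw [CStarMatrix.mul_apply, Fin.sum_univ_two, CStarMatrix.star_apply, CStarMatrix.star_apply,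
      h0, h0, h1, h1, mul_zero, add_zero]
    change (Matrix.vecMulVec (Pi.single o 1) (star (s i))).conjTranspose *
      Matrix.vecMulVec (Pi.single o 1) (star (s j)) = Matrix.vecMulVec (s i) (star (s j))
    rw [Matrix.conjTranspose_vecMulVec, Matrix.vecMulVec_mul_vecMulVec, star_star]
    simp
  obtain ⟨V, hV⟩ := exists_eq_star_mul_self
    (C.map_cstarMatrix_nonneg' 2 _ (star_mul_self_nonneg R))
  refine ⟨fun k i => CStarMatrix.ofMatrix.symm (V k i), fun i j => ?_⟩
  have h := congrFun (congrFun hV i) j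
  rw [CStarMatrix.map_apply, hR, CStarMatrix.mul_apply] at h
  exact h

/-- Normalising `v` gives `e`. This supplies the ancilla state that turns a fidelity into a single
squared overlap. -/
lemma exists_unit_dotProduct_eq_norm {ι : Type*} [Fintype ι] [Nonempty ι] (v : ι → ℂ) :
    ∃ e : ι → ℂ, star e ⬝ᵥ e = 1 ∧ ‖star e ⬝ᵥ v‖ ^ 2 = (star v ⬝ᵥ v).re := by
  classical
  by_cases hv : v = 0
  · obtain ⟨i⟩ := ‹Nonempty ι›
    exact ⟨Pi.single i 1, by simp, by simp [hv]⟩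
  set w := WithLp.toLp 2 v with hw
  have hvv : star v ⬝ᵥ v = ((‖w‖ : ℝ) : ℂ) ^ 2 := by
    rw [← inner_toLp, inner_self_eq_norm_sq_to_K]
    rfl
  have hn : ((‖w‖ : ℝ) : ℂ) ≠ 0 := by
    rw [Complex.ofReal_ne_zero, norm_ne_zero_iff, hw]
    simpa using hv
  refine ⟨((‖w‖ : ℝ) : ℂ)⁻¹ • v, ?_, ?_⟩
  · simp only [star_smul, smul_dotProduct, dotProduct_smul, hvv, smul_eq_mul, star_inv₀,
      RCLike.star_def, Complex.conj_ofReal]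
    field_simp
  · simp only [star_smul, smul_dotProduct, hvv, smul_eq_mul, star_inv₀,
      RCLike.star_def, Complex.conj_ofReal]
    rw [sq (Complex.ofReal _), inv_mul_cancel_left₀ hn, Complex.norm_real, ← Complex.ofReal_mul,
      Complex.ofReal_re, norm_norm, sq]

lemma norm_star_dotProduct_le_one {ι : Type*} [Fintype ι] {u v : ι → ℂ}
    (hu : star u ⬝ᵥ u = 1) (hv : star v ⬝ᵥ v = 1) : ‖star u ⬝ᵥ v‖ ≤ 1 := by
  rw [← inner_toLp]
  simpa [norm_toLp hu, norm_toLp hv] using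
    norm_inner_le_norm (𝕜 := ℂ) (WithLp.toLp 2 u) (WithLp.toLp 2 v)

lemma star_tensor_dotProduct_tensor {ι κ : Type*} [Fintype ι] [Fintype κ] (u u' : ι → ℂ)
    (v v' : κ → ℂ) :
    star (tensor u v) ⬝ᵥ tensor u' v' = (star u ⬝ᵥ u') * (star v ⬝ᵥ v') := by
  simp only [dotProduct, tensor, Fintype.sum_prod_type, Finset.sum_mul_sum, Pi.star_apply,
    star_mul']
  exact Finset.sum_congr rfl fun _ _ => Finset.sum_congr rfl fun _ _ => by ring

lemma trackingFidelity_le {ι κ : Type} [Fintype ι] [DecidableEq ι] [Fintype κ] [DecidableEq κ]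
    {π₁ π₂ φ : ℝ} (hφ : φ ∈ Set.Ico 0 (Real.pi / 4)) (h₁ : 0 ≤ π₁) (h₂ : 0 ≤ π₂)
    (h : π₁ + π₂ = 1) {s₁ s₂ : ι → ℂ} {t₁ t₂ : κ → ℂ}
    (hs₁ : star s₁ ⬝ᵥ s₁ = 1) (hs₂ : star s₂ ⬝ᵥ s₂ = 1) (ht₁ : star t₁ ⬝ᵥ t₁ = 1)
    (ht₂ : star t₂ ⬝ᵥ t₂ = 1) (hs : star s₁ ⬝ᵥ s₂ = ((Real.sin (2 * φ) : ℝ) : ℂ))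
    (ht : star t₁ ⬝ᵥ t₂ = ((Real.sin (2 * φ) ^ 2 : ℝ) : ℂ)) (C : QuantumOperation ι κ) :
    trackingFidelity π₁ π₂ s₁ s₂ t₁ t₂ C ≤ optimalFidelity π₁ π₂ φ := by
  have : Nonempty κ := by
    by_contra hκ
    rw [not_nonempty_iff] at hκ
    simp [dotProduct] at ht₁
  obtain ⟨V, hV⟩ := exists_purification C.toCP ![s₁, s₂]
  let ψ (i : Fin 2) : (Fin 2 × κ) × κ → ℂ := fun p => V p.1.1 i p.1.2 p.2
  let Vt (i : Fin 2) (t : κ → ℂ) : Fin 2 × κ → ℂ := fun p => (V p.1 i).mulVec t p.2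
  -- Trace preservation carries the source overlap to the purifications; the order flips, harmlessly
  -- since the overlap is real.
  have hψ (i j) : star (ψ i) ⬝ᵥ ψ j = star (![s₁, s₂] j) ⬝ᵥ ![s₁, s₂] i := by
    have h1 := C.tr_map (CStarMatrix.ofMatrix (Matrix.vecMulVec (![s₁, s₂] i) (star (![s₁, s₂] j))))
    have h2 : tr (CStarMatrix.ofMatrix (Matrix.vecMulVec (![s₁, s₂] i) (star (![s₁, s₂] j)))) =
        star (![s₁, s₂] j) ⬝ᵥ ![s₁, s₂] i :=
      (Matrix.trace_vecMulVec _ _).trans (dotProduct_comm _ _)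
    rw [← h2, ← h1, tr, hV, Matrix.trace_sum]
    simp only [dotProduct, ψ, Fintype.sum_prod_type, Matrix.trace, Matrix.diag_apply,
      Matrix.mul_apply, Matrix.conjTranspose_apply, Pi.star_apply]
    exact Finset.sum_congr rfl fun _ _ => Finset.sum_comm
  have hfid (i) (t : κ → ℂ) : tr (C.toCP (pureState (![s₁, s₂] i)) * pureState t) =
      star (Vt i t) ⬝ᵥ Vt i t := by
    change Matrix.trace (CStarMatrix.ofMatrix.symm (C.toCP (CStarMatrix.ofMatrix
      (Matrix.vecMulVec (![s₁, s₂] i) (star (![s₁, s₂] i))))) * Matrix.vecMulVec t (star t)) = _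
    rw [hV, Finset.sum_mul, Matrix.trace_sum]
    simp only [Matrix.mul_vecMulVec, Matrix.trace_vecMulVec, ← Matrix.mulVec_mulVec]
    rw [dotProduct, Fintype.sum_prod_type]
    refine Finset.sum_congr rfl fun k _ => ?_
    rw [dotProduct_comm, Matrix.dotProduct_mulVec, ← Matrix.star_mulVec]
    rfl
  -- The conjugated target is needed since pairing with `star t` applies `V` to `t`.
  have hτ (i) (t : κ → ℂ) (e : Fin 2 × κ → ℂ) :
      star (tensor e (star t)) ⬝ᵥ ψ i = star e ⬝ᵥ Vt i t := by
    simp only [dotProduct, tensor, ψ, Vt, Fintype.sum_prod_type, Matrix.mulVec, Pi.star_apply,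
      star_mul', star_star, Finset.mul_sum]
    refine Finset.sum_congr rfl fun _ _ => Finset.sum_congr rfl fun _ _ =>
      Finset.sum_congr rfl fun _ _ => by ring
  obtain ⟨e₁, he₁, hf₁⟩ := exists_unit_dotProduct_eq_norm (Vt 0 t₁)
  obtain ⟨e₂, he₂, hf₂⟩ := exists_unit_dotProduct_eq_norm (Vt 1 t₂)
  have hstar (u v : κ → ℂ) : star (star u) ⬝ᵥ star v = star v ⬝ᵥ u := by
    rw [star_star, dotProduct_comm]
  have key := mul_overlapSq_add_le hφ h₁ h₂ h (x := ψ 0) (y := ψ 1)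
    (u := tensor e₁ (star t₁)) (v := tensor e₂ (star t₂))
    (by simpa [hψ] using hs₁) (by simpa [hψ] using hs₂)
    (by rw [star_tensor_dotProduct_tensor, he₁, hstar, ht₁, one_mul])
    (by rw [star_tensor_dotProduct_tensor, he₂, hstar, ht₂, one_mul])
    (by rw [hψ]; exact star_dotProduct_comm hs)
    (by
      rw [star_tensor_dotProduct_tensor, hstar, star_dotProduct_comm ht, norm_mul,
        Complex.norm_real, Real.norm_of_nonneg (sq_nonneg _)]
      exact mul_le_of_le_one_left (sq_nonneg _) (norm_star_dotProduct_le_one he₁ he₂))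
  rw [overlapSq, overlapSq, hτ, hτ, hf₁, hf₂, ← hfid, ← hfid] at key
  exact key

/-- An optimal isometry is a hypothesis so that both one-to-two-qubit and qubit-to-qubit operations
are covered. -/
lemma isGreatest_trackingFidelity {ι κ : Type} [Fintype ι] [DecidableEq ι] [Fintype κ]
    [DecidableEq κ] {π₁ π₂ φ : ℝ} (hφ : φ ∈ Set.Ico 0 (Real.pi / 4)) (h₁ : 0 ≤ π₁) (h₂ : 0 ≤ π₂)
    (h : π₁ + π₂ = 1) {s₁ s₂ : ι → ℂ} {t₁ t₂ : κ → ℂ}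
    (hs₁ : star s₁ ⬝ᵥ s₁ = 1) (hs₂ : star s₂ ⬝ᵥ s₂ = 1) (ht₁ : star t₁ ⬝ᵥ t₁ = 1)
    (ht₂ : star t₂ ⬝ᵥ t₂ = 1) (hs : star s₁ ⬝ᵥ s₂ = ((Real.sin (2 * φ) : ℝ) : ℂ))
    (ht : star t₁ ⬝ᵥ t₂ = ((Real.sin (2 * φ) ^ 2 : ℝ) : ℂ))
    (hW : ∃ W : Matrix κ ι ℂ, W.conjTranspose * W = 1 ∧
      π₁ * overlapSq t₁ (W.mulVec s₁) + π₂ * overlapSq t₂ (W.mulVec s₂) =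
        optimalFidelity π₁ π₂ φ) :
    IsGreatest (Set.range (trackingFidelity π₁ π₂ s₁ s₂ t₁ t₂)) (optimalFidelity π₁ π₂ φ) := by
  constructor
  · obtain ⟨W, hW, hf⟩ := hW
    refine ⟨QuantumOperation.ofIsometry W hW, ?_⟩
    rw [trackingFidelity, tr_ofIsometry_mul_pureState, tr_ofIsometry_mul_pureState, hf]
  · rintro _ ⟨C, rfl⟩
    exact trackingFidelity_le hφ h₁ h₂ h hs₁ hs₂ ht₁ ht₂ hs ht C

lemma exists_optimal_unitary {ι : Type*} [Fintype ι] [DecidableEq ι] [Nontrivial ι]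
    {π₁ π₂ φ : ℝ} (hφ : φ ∈ Set.Ico 0 (Real.pi / 4)) (h : π₁ + π₂ = 1) {s₁ s₂ t₁ t₂ : ι → ℂ}
    (hs₁ : star s₁ ⬝ᵥ s₁ = 1) (hs₂ : star s₂ ⬝ᵥ s₂ = 1) (ht₁ : star t₁ ⬝ᵥ t₁ = 1)
    (ht₂ : star t₂ ⬝ᵥ t₂ = 1) (hs : star s₁ ⬝ᵥ s₂ = ((Real.sin (2 * φ) : ℝ) : ℂ))
    (ht : star t₁ ⬝ᵥ t₂ = ((Real.sin (2 * φ) ^ 2 : ℝ) : ℂ)) :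
    ∃ U : Matrix.unitaryGroup ι ℂ,
      π₁ * overlapSq t₁ ((U : Matrix ι ι ℂ).mulVec s₁) +
        π₂ * overlapSq t₂ ((U : Matrix ι ι ℂ).mulVec s₂) = optimalFidelity π₁ π₂ φ := by
  obtain ⟨h0, h1⟩ := sin_two_mul_mem hφ
  obtain ⟨x, y, hx, hy, hxy, hf⟩ := exists_optimal_pair hφ h ht₁ ht₂ ht
  obtain ⟨U, hU₁, hU₂⟩ := exists_unitary_mulVec_eq hs₁ hs₂ hx hy (by nlinarith) hs hxy
  exact ⟨U, by rw [hU₁, hU₂, hf]⟩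

lemma star_mulVec_dotProduct_mulVec {ι κ : Type*} [Fintype ι] [DecidableEq ι] [Fintype κ]
    {W : Matrix κ ι ℂ} (hW : W.conjTranspose * W = 1) (x y : ι → ℂ) :
    star (W.mulVec x) ⬝ᵥ W.mulVec y = star x ⬝ᵥ y := by
  rw [Matrix.star_mulVec, Matrix.dotProduct_mulVec, Matrix.vecMul_vecMul, hW, Matrix.vecMul_one]

/-! ### The cloning states and unitary cloners -/

lemma ketA_dotProduct_self (φ : ℝ) : star (ketA φ) ⬝ᵥ ketA φ = 1 := by
  have := Real.sin_sq_add_cos_sq φ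
  simp only [ketA, dotProduct, Fin.sum_univ_two, Pi.star_apply, Matrix.cons_val_zero,
    Matrix.cons_val_one, RCLike.star_def, Complex.conj_ofReal]
  norm_cast
  linarith

lemma ketB_dotProduct_self (φ : ℝ) : star (ketB φ) ⬝ᵥ ketB φ = 1 := by
  have := Real.sin_sq_add_cos_sq φ
  simp only [ketB, dotProduct, Fin.sum_univ_two, Pi.star_apply, Matrix.cons_val_zero,
    Matrix.cons_val_one, RCLike.star_def, Complex.conj_ofReal]
  norm_cast
  linarith

lemma ketA_dotProduct_ketB (φ : ℝ) :
    star (ketA φ) ⬝ᵥ ketB φ = ((Real.sin (2 * φ) : ℝ) : ℂ) := by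
  simp only [ketA, ketB, dotProduct, Fin.sum_univ_two, Pi.star_apply, Matrix.cons_val_zero,
    Matrix.cons_val_one, RCLike.star_def, Complex.conj_ofReal, Real.sin_two_mul]
  norm_cast
  ring

lemma ket0_dotProduct_self : star ket0 ⬝ᵥ ket0 = 1 := by
  simp [ket0, dotProduct, Fin.sum_univ_two]

/-- The isometry `u ↦ u ⊗ |0⟩`. -/
def adjoinBlank : Matrix (Fin 2 × Fin 2) (Fin 2) ℂ :=
  fun p i => if p.1 = i then ket0 p.2 else 0

lemma adjoinBlank_mulVec (u : Fin 2 → ℂ) : adjoinBlank.mulVec u = tensor u ket0 := by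
  ext p
  simp [adjoinBlank, Matrix.mulVec, dotProduct, tensor, mul_comm]

lemma adjoinBlank_isometry : adjoinBlank.conjTranspose * adjoinBlank = 1 := by
  ext i j
  fin_cases i <;> fin_cases j <;>
    simp [adjoinBlank, Matrix.mul_apply, Fintype.sum_prod_type, ket0]

variable {π₁ π₂ φ : ℝ}

lemma tensor_ketA_ket0_dotProduct_self (φ : ℝ) :
    star (tensor (ketA φ) ket0) ⬝ᵥ tensor (ketA φ) ket0 = 1 := by
  rw [star_tensor_dotProduct_tensor, ketA_dotProduct_self, ket0_dotProduct_self, one_mul]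

lemma tensor_ketB_ket0_dotProduct_self (φ : ℝ) :
    star (tensor (ketB φ) ket0) ⬝ᵥ tensor (ketB φ) ket0 = 1 := by
  rw [star_tensor_dotProduct_tensor, ketB_dotProduct_self, ket0_dotProduct_self, one_mul]

lemma tensor_ketA_ket0_dotProduct_tensor_ketB_ket0 (φ : ℝ) :
    star (tensor (ketA φ) ket0) ⬝ᵥ tensor (ketB φ) ket0 = ((Real.sin (2 * φ) : ℝ) : ℂ) := by
  rw [star_tensor_dotProduct_tensor, ketA_dotProduct_ketB, ket0_dotProduct_self, mul_one]

lemma tensor_ketA_ketA_dotProduct_self (φ : ℝ) :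
    star (tensor (ketA φ) (ketA φ)) ⬝ᵥ tensor (ketA φ) (ketA φ) = 1 := by
  rw [star_tensor_dotProduct_tensor, ketA_dotProduct_self, one_mul]

lemma tensor_ketB_ketB_dotProduct_self (φ : ℝ) :
    star (tensor (ketB φ) (ketB φ)) ⬝ᵥ tensor (ketB φ) (ketB φ) = 1 := by
  rw [star_tensor_dotProduct_tensor, ketB_dotProduct_self, one_mul]

lemma tensor_ketA_ketA_dotProduct_tensor_ketB_ketB (φ : ℝ) :
    star (tensor (ketA φ) (ketA φ)) ⬝ᵥ tensor (ketB φ) (ketB φ) =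
      ((Real.sin (2 * φ) ^ 2 : ℝ) : ℂ) := by
  rw [star_tensor_dotProduct_tensor, ketA_dotProduct_ketB, ← Complex.ofReal_mul, sq]

lemma exists_optimal_cloner (hφ : φ ∈ Set.Ico 0 (Real.pi / 4)) (h : π₁ + π₂ = 1) :
    ∃ U, globalFidelity π₁ π₂ φ U = optimalFidelity π₁ π₂ φ :=
  exists_optimal_unitary hφ h (tensor_ketA_ket0_dotProduct_self φ)
    (tensor_ketB_ket0_dotProduct_self φ) (tensor_ketA_ketA_dotProduct_self φ)
    (tensor_ketB_ketB_dotProduct_self φ) (tensor_ketA_ket0_dotProduct_tensor_ketB_ket0 φ)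
    (tensor_ketA_ketA_dotProduct_tensor_ketB_ketB φ)

lemma isGreatest_globalFidelity (hφ : φ ∈ Set.Ico 0 (Real.pi / 4)) (h₁ : 0 ≤ π₁) (h₂ : 0 ≤ π₂)
    (h : π₁ + π₂ = 1) :
    IsGreatest (Set.range (globalFidelity π₁ π₂ φ)) (optimalFidelity π₁ π₂ φ) := by
  refine ⟨exists_optimal_cloner hφ h, ?_⟩
  rintro _ ⟨U, rfl⟩
  have hU := Matrix.UnitaryGroup.star_mul_self U
  refine mul_overlapSq_add_le hφ h₁ h₂ h ?_ ?_ (tensor_ketA_ketA_dotProduct_self φ)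
    (tensor_ketB_ketB_dotProduct_self φ) ?_ ?_
  · rw [star_mulVec_dotProduct_mulVec hU, tensor_ketA_ket0_dotProduct_self]
  · rw [star_mulVec_dotProduct_mulVec hU, tensor_ketB_ket0_dotProduct_self]
  · rw [star_mulVec_dotProduct_mulVec hU, tensor_ketA_ket0_dotProduct_tensor_ketB_ket0]
  · rw [tensor_ketA_ketA_dotProduct_tensor_ketB_ketB, Complex.norm_real,
      Real.norm_of_nonneg (sq_nonneg _)]

end Cloning

theorem mainTheorem5 (φ : ℝ) (hφ : φ ∈ Set.Ico 0 (Real.pi / 4)) :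
    Cloning.indicator φ ≤ 0 ∧
    (∀ π₁ π₂ : ℝ, 0 ≤ π₁ → 0 ≤ π₂ → π₁ + π₂ = 1 →
      -- two-qubit cloning unitaries
      IsGreatest (Set.range (Cloning.globalFidelity π₁ π₂ φ)) (Cloning.optimalFidelity π₁ π₂ φ) ∧
      -- arbitrary quantum operations from one qubit to two qubits
      IsGreatest
        (Set.range (Cloning.trackingFidelity π₁ π₂ (Cloning.ketA φ) (Cloning.ketB φ)
          (Cloning.tensor (Cloning.ketA φ) (Cloning.ketA φ))
          (Cloning.tensor (Cloning.ketB φ) (Cloning.ketB φ))))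
        (Cloning.optimalFidelity π₁ π₂ φ) ∧
      -- quantum operations between fictitious qubit sources and targets with overlaps `⟨a0|b0⟩` and `⟨aa|bb⟩`
      (∀ s₁ s₂ t₁ t₂ : Fin 2 → ℂ,
        star s₁ ⬝ᵥ s₁ = 1 → star s₂ ⬝ᵥ s₂ = 1 → star t₁ ⬝ᵥ t₁ = 1 → star t₂ ⬝ᵥ t₂ = 1 →
        star s₁ ⬝ᵥ s₂ = ((Real.sin (2 * φ) : ℝ) : ℂ) →
        star t₁ ⬝ᵥ t₂ = ((Real.sin (2 * φ) ^ 2 : ℝ) : ℂ) →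
        IsGreatest (Set.range (Cloning.trackingFidelity π₁ π₂ s₁ s₂ t₁ t₂))
          (Cloning.optimalFidelity π₁ π₂ φ))) ∧
    -- equal priors: the optimum of Bruß et al.
    Cloning.optimalFidelity (1 / 2) (1 / 2) φ = Cloning.brussFidelity φ ∧
    IsGreatest (Set.range (Cloning.globalFidelity (1 / 2) (1 / 2) φ))
      (Cloning.brussFidelity φ) := by
  refine ⟨Cloning.indicator_nonpos hφ, fun π₁ π₂ h₁ h₂ h => ⟨?_, ?_, ?_⟩,
    Cloning.optimalFidelity_half hφ, ?_⟩
  · exact Cloning.isGreatest_globalFidelity hφ h₁ h₂ h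
  · refine Cloning.isGreatest_trackingFidelity hφ h₁ h₂ h (Cloning.ketA_dotProduct_self φ)
      (Cloning.ketB_dotProduct_self φ) (Cloning.tensor_ketA_ketA_dotProduct_self φ)
      (Cloning.tensor_ketB_ketB_dotProduct_self φ) (Cloning.ketA_dotProduct_ketB φ)
      (Cloning.tensor_ketA_ketA_dotProduct_tensor_ketB_ketB φ) ?_
    obtain ⟨U, hU⟩ := Cloning.exists_optimal_cloner hφ h
    let W : Matrix (Fin 2 × Fin 2) (Fin 2 × Fin 2) ℂ := U
    have hW : W.conjTranspose * W = 1 := Matrix.UnitaryGroup.star_mul_self U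
    -- Adjoining the blank and then applying an optimal unitary is an isometry, so unitaries already
    -- reach the optimum over operations.
    refine ⟨W * Cloning.adjoinBlank, ?_, ?_⟩
    · rw [Matrix.conjTranspose_mul, Matrix.mul_assoc, ← Matrix.mul_assoc _ W, hW,
        Matrix.one_mul, Cloning.adjoinBlank_isometry]
    · rw [← Matrix.mulVec_mulVec, ← Matrix.mulVec_mulVec, Cloning.adjoinBlank_mulVec,
        Cloning.adjoinBlank_mulVec]
      exact hU
  · intro s₁ s₂ t₁ t₂ hs₁ hs₂ ht₁ ht₂ hs ht
    obtain ⟨U, hU⟩ := Cloning.exists_optimal_unitary hφ h hs₁ hs₂ ht₁ ht₂ hs ht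
    exact Cloning.isGreatest_trackingFidelity hφ h₁ h₂ h hs₁ hs₂ ht₁ ht₂ hs ht
      ⟨U, Matrix.UnitaryGroup.star_mul_self U, hU⟩
  · rw [← Cloning.optimalFidelity_half hφ]
    exact Cloning.isGreatest_globalFidelity hφ (by norm_num) (by norm_num) (by norm_num)
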